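/- Let $n\ge 1$, $A\in\mathbb R^{n\times d}$, $y\in\mathbb R^n$, $\lambda>0$, $\eta>0$. Let the coordinates $\{1,\dots,d\}$ be divided into disjoint groups $g_1,\dots,g_k$ with $|g_j|=p_j$ and $\sum_{j}p_j=d$, let $u_{g_j}\in\mathbb R^{p_j}$ denote the subvector of $u\in\mathbb R^d$ with indices in $g_j$, and let $C_1,\dots,C_k$ be symmetric positive definite matrices, $C_j\in\mathbb R^{p_j\times p_j}$. For a symmetric positive definite matrix $C$ write $\|v\|_C=\sqrt{v^TC^{-1}v}$ (the Mahalanobis norm). Let $\mathbb R^k_+=\{\theta\in\mathbb R^k:\theta_j>0 \text{ for all } j\}$, and for $\theta\in\mathbb R^k_+$ let $D_\theta\in\mathbb R^{d\times d}$ be the block-diagonal matrix (with respect to the groups) with blocks $\theta_1C_1,\dots,\theta_kC_k$. Define $$J(u,\theta)=\frac1{2n}\|y-Au\|_2^2+\frac{\lambda}{2\sqrt2}\|u\|_{D_\theta}^2+\frac{\lambda}{\sqrt2}\sum_{j=1}^k\bigl(\theta_j-\eta\log\theta_j\bigr),\qquad (u,\theta)\in\mathbb R^d\times\mathbb R^k_+,$$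 $$f_j(u)=\frac{\eta}{2}+\sqrt{\frac{\eta^2}{4}+\frac{\|u_{g_j}\|_{C_j}^2}{2}},\qquad 1\le j\le k .$$ The GS-IAS algorithm, started at any $\theta^0\in\mathbb R^k_+$, is the iteration $$u^{\ell+1}=\Bigl(\frac{A^TA}{n}+\frac{\lambda}{\sqrt2}D_{\theta^\ell}^{-1}\Bigr)^{-1}\frac{A^Ty}{n},\qquad \theta_j^{\ell+1}=f_j(u^{\ell+1})\quad(1\le j\le k),\qquad \ell=0,1,2,\dots$$ Then: 1. $J$ is strictly convex on $\mathbb R^d\times\mathbb R^k_+$, and it has a unique minimizer $(\hat u,\hat\theta)$ there (the MAP estimator). 2. The $u$-iterates converge at least linearly to $\hat u$ in the Mahalanobis norm $\|\cdot\|_{D_{\hat\theta}}$: there is $\mu\in[0,1)$ such that for every $\theta^0\in\mathbb R^k_+$ the iterates satisfy $\|u^\ell-\hat u\|_{D_{\hat\theta}}\to0$, and $\|u^{\ell+1}-\hat u\|_{D_{\hat\theta}}\le\mu\,\|u^\ell-\hat u\|_{D_{\hat\theta}}$ for all sufficiently large $\ell$. 3. $\hat u$ is the (unique) global minimizer over $\mathbb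 R^d$ of $$F(u)=\frac1{2n}\|y-Au\|_2^2+\lambda R_\eta(u),\qquad R_\eta(u)=\frac1{\sqrt2}\sum_{j=1}^k\Bigl[\frac{\|u_{g_j}\|_{C_j}^2}{2f_j(u)}+f_j(u)-\eta\log f_j(u)\Bigr].$$ -/

import Mathlib

open scoped Matrix

namespace GSIAS

noncomputable section

/-- The Mahalanobis norm `‖v‖_C = √(vᵀ C⁻¹ v)` of a vector `v` for a (positive definite)
covariance matrix `C`. -/
def mahalanobisNorm {ι : Type*} [Fintype ι] [DecidableEq ι] (C : Matrix ι ι ℝ) (v : ι → ℝ) : ℝ :=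
  Real.sqrt (v ⬝ᵥ (C⁻¹ *ᵥ v))

/-- A division of the coordinates `1, …, d` into `k` groups is given by the map
`g : Fin d → Fin k` that sends a coordinate to the label of its group. `Group g j` is the
`j`-th group of coordinates. -/
abbrev Group {d k : ℕ} (g : Fin d → Fin k) (j : Fin k) : Type := {i : Fin d // g i = j}

/-- The subvector of `u` with the coordinates of the `j`-th group. -/
def groupPart {d k : ℕ} (g : Fin d → Fin k) (u : Fin d → ℝ) (j : Fin k) : Group g j → ℝ :=
  fun i => u i.1

/-- The matrix `D_θ` of size `d × d` that is block-diagonal with respect to the groups, with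
blocks `θ_j C_j`. -/
def blockCov {d k : ℕ} (g : Fin d → Fin k) (C : (j : Fin k) → Matrix (Group g j) (Group g j) ℝ)
    (θ : Fin k → ℝ) : Matrix (Fin d) (Fin d) ℝ :=
  Matrix.reindex (Equiv.sigmaFiberEquiv g) (Equiv.sigmaFiberEquiv g)
    (Matrix.blockDiagonal' fun j => θ j • C j)

/-- The data misfit `(1 / 2n) ‖y - A u‖₂²`, with the Euclidean norm. -/
def misfit {n d : ℕ} (A : Matrix (Fin n) (Fin d) ℝ) (y : Fin n → ℝ) (u : Fin d → ℝ) : ℝ :=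
  1 / (2 * (n : ℝ)) * ‖WithLp.toLp 2 (y - A *ᵥ u)‖ ^ 2

/-- The domain `ℝ^d × ℝ^k_+`, where `ℝ^k_+` is the set of vectors with positive entries. -/
def domain (d k : ℕ) : Set ((Fin d → ℝ) × (Fin k → ℝ)) :=
  {p | ∀ j, 0 < p.2 j}

/-- The objective
`J(u, θ) = (1/2n) ‖y - A u‖₂² + (λ / (2√2)) ‖u‖²_{D_θ} + (λ / √2) ∑_j (θ_j - η log θ_j)`. -/
def objJ {n d k : ℕ} (A : Matrix (Fin n) (Fin d) ℝ) (y : Fin n → ℝ) (g : Fin d → Fin k)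
    (C : (j : Fin k) → Matrix (Group g j) (Group g j) ℝ) (lam η : ℝ)
    (p : (Fin d → ℝ) × (Fin k → ℝ)) : ℝ :=
  misfit A y p.1
    + lam / (2 * Real.sqrt 2) * mahalanobisNorm (blockCov g C p.2) p.1 ^ 2
    + lam / Real.sqrt 2 * ∑ j, (p.2 j - η * Real.log (p.2 j))

/-- `p = (û, θ̂)` is a MAP estimator: a minimizer of `J` over `ℝ^d × ℝ^k_+`. -/
def IsMAP {n d k : ℕ} (A : Matrix (Fin n) (Fin d) ℝ) (y : Fin n → ℝ) (g : Fin d → Fin k)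
    (C : (j : Fin k) → Matrix (Group g j) (Group g j) ℝ) (lam η : ℝ)
    (p : (Fin d → ℝ) × (Fin k → ℝ)) : Prop :=
  p ∈ domain d k ∧ IsMinOn (objJ A y g C lam η) (domain d k) p

/-- The function `f_j(u) = η/2 + √(η²/4 + ‖u_{g_j}‖²_{C_j} / 2)`. -/
def thetaOf {d k : ℕ} (g : Fin d → Fin k) (C : (j : Fin k) → Matrix (Group g j) (Group g j) ℝ)
    (η : ℝ) (u : Fin d → ℝ) (j : Fin k) : ℝ :=
  η / 2 + Real.sqrt (η ^ 2 / 4 + mahalanobisNorm (C j) (groupPart g u j) ^ 2 / 2)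

/-- The `u`-update `(AᵀA / n + (λ/√2) D_θ⁻¹)⁻¹ (Aᵀ y / n)`. -/
def uUpdate {n d k : ℕ} (A : Matrix (Fin n) (Fin d) ℝ) (y : Fin n → ℝ) (g : Fin d → Fin k)
    (C : (j : Fin k) → Matrix (Group g j) (Group g j) ℝ) (lam : ℝ) (θ : Fin k → ℝ) : Fin d → ℝ :=
  ((1 / (n : ℝ)) • (Aᵀ * A) + (lam / Real.sqrt 2) • (blockCov g C θ)⁻¹)⁻¹ *ᵥ
    ((1 / (n : ℝ)) • (Aᵀ *ᵥ y))

/-- `(u, θ)` is a run of the group-sparse iterative alternating scheme, started at some `θ⁰` with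
positive entries; the `u`-iterates are `u¹, u², …`, and `u⁰` is not used by the scheme. -/
structure IsRun {n d k : ℕ} (A : Matrix (Fin n) (Fin d) ℝ) (y : Fin n → ℝ) (g : Fin d → Fin k)
    (C : (j : Fin k) → Matrix (Group g j) (Group g j) ℝ) (lam η : ℝ)
    (u : ℕ → Fin d → ℝ) (θ : ℕ → Fin k → ℝ) : Prop where
  init : ∀ j, 0 < θ 0 j
  u_step : ∀ l, u (l + 1) = uUpdate A y g C lam (θ l)
  θ_step : ∀ l, θ (l + 1) = thetaOf g C η (u (l + 1))

/-- The regularizer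
`R_η(u) = (1/√2) ∑_j [‖u_{g_j}‖²_{C_j} / (2 f_j(u)) + f_j(u) - η log f_j(u)]`. -/
def regR {d k : ℕ} (g : Fin d → Fin k) (C : (j : Fin k) → Matrix (Group g j) (Group g j) ℝ)
    (η : ℝ) (u : Fin d → ℝ) : ℝ :=
  1 / Real.sqrt 2 * ∑ j, (mahalanobisNorm (C j) (groupPart g u j) ^ 2 / (2 * thetaOf g C η u j)
    + thetaOf g C η u j - η * Real.log (thetaOf g C η u j))

/-- The objective `F(u) = (1/2n) ‖y - A u‖₂² + λ R_η(u)`. -/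
def objF {n d k : ℕ} (A : Matrix (Fin n) (Fin d) ℝ) (y : Fin n → ℝ) (g : Fin d → Fin k)
    (C : (j : Fin k) → Matrix (Group g j) (Group g j) ℝ) (lam η : ℝ) (u : Fin d → ℝ) : ℝ :=
  misfit A y u + lam * regR g C η u

end

end GSIAS

namespace GSIAS

open Filter Topology

/-! ### Scalar facts about the scale update -/

/-! Factor `C_j⁻¹ = B_jᵀ B_j` and put `W_j u = B_j u_{g_j}`. Then `J` is, on its domain, the
`energy` with a least-squares misfit and group terms `‖W_j u‖² / (2 θ_j) + θ_j - η log θ_j`, and `F`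
is the same energy with `θ` minimized out. The maps `W_j` are jointly injective. Strict convexity
comes from the quadratic-over-linear identity `sq_norm_combo` and the strict concavity of `log`. A
minimizer exists because the reduced energy has compact sublevel sets
(`isCompact_energy_scales_le`). Each half-step of the scheme minimizes the energy exactly in one
variable, so the reduced energy is a Lyapunov function. If it does not drop at `u`, then `u` solves
the normal equation with its own optimal scales. The tangent plane bound `groupTerm_tangent_le`
makes such a point a global minimizer, and strict convexity identifies it with `û`. Compactness then
gives convergence (`tendsto_iterate_of_descent`). For the rate, subtract the normal equations of the
new iterate and of `û` and apply Cauchy-Schwarz. The error is multiplied by factors that tend, group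
by group, to `2 (f - η) / (2 f - η) < 1` with `f = θ̂_j` (`updateFactor_self_lt_one`). The bound `μ`
depends on the minimizer only, not on the run. -/

/-- The minimizer over `t > 0` of `s² / (2t) + t - η log t`. -/
noncomputable def optScale (η s : ℝ) : ℝ := η / 2 + Real.sqrt (η ^ 2 / 4 + s ^ 2 / 2)

/-- The contribution `s² / (2t) + t - η log t` of a group with norm `s` and scale `t`. -/
noncomputable def groupTerm (η s t : ℝ) : ℝ := s ^ 2 / (2 * t) + t - η * Real.log t

theorem le_optScale {η : ℝ} (_hη : 0 < η) (s : ℝ) : η ≤ optScale η s := by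
  have : η / 2 ≤ Real.sqrt (η ^ 2 / 4 + s ^ 2 / 2) :=
    Real.le_sqrt_of_sq_le (by nlinarith [sq_nonneg s])
  unfold optScale
  linarith

theorem optScale_pos {η : ℝ} (hη : 0 < η) (s : ℝ) : 0 < optScale η s :=
  hη.trans_le (le_optScale hη s)

/-- The stationarity condition of `groupTerm` in `t`, cleared of denominators. The other scalar
facts use the square root only through this relation and `le_optScale`. -/
theorem optScale_sq (η s : ℝ) : optScale η s ^ 2 - η * optScale η s = s ^ 2 / 2 := by
  have := Real.sq_sqrt (show 0 ≤ η ^ 2 / 4 + s ^ 2 / 2 by positivity)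
  unfold optScale
  linear_combination this

theorem continuous_optScale (η : ℝ) : Continuous (optScale η) := by
  unfold optScale
  fun_prop

theorem le_two_mul_optScale {η : ℝ} (hη : 0 < η) (s : ℝ) : s ≤ 2 * optScale η s := by
  nlinarith [optScale_sq η s, optScale_pos hη s]

/-- The tangent line bound `η (log t - log t₀) ≤ η (t - t₀) / t₀`. -/
theorem mul_log_le {η t t₀ : ℝ} (hη : 0 < η) (ht : 0 < t) (ht₀ : 0 < t₀) :
    η * Real.log t ≤ η * Real.log t₀ + η * (t - t₀) / t₀ := by
  have h := Real.log_le_sub_one_of_pos (div_pos ht ht₀)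
  rw [Real.log_div ht.ne' ht₀.ne'] at h
  have h2 := mul_le_mul_of_nonneg_left h hη.le
  have : η * (t - t₀) / t₀ = η * (t / t₀ - 1) := by field_simp
  linarith

/-- Once `log t` is replaced by its tangent at `f`, the gap is exactly `(t - f)² (f - η) / (f t)`,
nonnegative because `f ≥ η`. -/
theorem groupTerm_optScale_le {η t : ℝ} (hη : 0 < η) (s : ℝ) (ht : 0 < t) :
    groupTerm η s (optScale η s) ≤ groupTerm η s t := by
  have hf := optScale_pos hη s
  have hsq := optScale_sq η s
  have hge := le_optScale hη s
  set f := optScale η s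
  have hlog := mul_log_le hη ht hf
  have hs : s ^ 2 = 2 * (f ^ 2 - η * f) := by linarith
  have key : s ^ 2 / (2 * t) + t - (s ^ 2 / (2 * f) + f) - η * (t - f) / f
      = (t - f) ^ 2 * (f - η) / (f * t) := by
    rw [hs]
    field_simp
    ring
  have : 0 ≤ (t - f) ^ 2 * (f - η) / (f * t) := by
    have : 0 ≤ f - η := by linarith
    positivity
  unfold groupTerm
  linarith

/-- Coercivity in the scale: the tangent to `log` at `2 η` uses up only half of the linear term. -/
theorem half_sub_le_groupTerm {η t : ℝ} (hη : 0 < η) (s : ℝ) (ht : 0 < t) :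
    t / 2 - η * Real.log (2 * η) ≤ groupTerm η s t := by
  have hlog := mul_log_le hη ht (show 0 < 2 * η by positivity)
  have h1 : η * (t - 2 * η) / (2 * η) = t / 2 - η := by field_simp
  have : 0 ≤ s ^ 2 / (2 * t) := by positivity
  unfold groupTerm
  linarith

theorem optScale_sub (η s s' : ℝ) :
    (optScale η s - optScale η s') * (optScale η s + optScale η s' - η)
      = (s - s') * (s + s') / 2 := by
  linear_combination optScale_sq η s - optScale_sq η s'

/-- The Lipschitz factor of the update of a group, relative to the limiting scale. -/
noncomputable def updateFactor (η s s' : ℝ) : ℝ :=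
  (s + s') * s' / (2 * (optScale η s + optScale η s' - η) * optScale η s)

/-- With `s² = 2 (f² - η f)` the factor equals `2 (f - η) / (2 f - η)`; the strict inequality is due
to `η > 0`. -/
theorem updateFactor_self_lt_one {η : ℝ} (hη : 0 < η) (s : ℝ) : updateFactor η s s < 1 := by
  have hf := optScale_pos hη s
  have hge := le_optScale hη s
  have hsq := optScale_sq η s
  unfold updateFactor
  rw [div_lt_one (by apply mul_pos _ hf; linarith)]
  nlinarith

theorem continuous_updateFactor {η : ℝ} (hη : 0 < η) (s' : ℝ) :
    Continuous fun s => updateFactor η s s' := by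
  unfold updateFactor
  have := continuous_optScale η
  refine Continuous.div (by fun_prop) (by fun_prop) fun s => ?_
  have := le_optScale hη s
  have := le_optScale hη s'
  have : 0 < 2 * (optScale η s + optScale η s' - η) * optScale η s :=
    mul_pos (by linarith) (by linarith)
  exact this.ne'

theorem abs_inv_optScale_sub_mul {η s s' : ℝ} (hη : 0 < η) (hs : 0 ≤ s) (hs' : 0 ≤ s') :
    |(optScale η s')⁻¹ - (optScale η s)⁻¹| * s'
      = updateFactor η s s' * |s - s'| / optScale η s' := by
  have hf := optScale_pos hη s
  have hf' := optScale_pos hη s'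
  have h1 := le_optScale hη s
  have h2 := le_optScale hη s'
  have h := optScale_sub η s s'
  unfold updateFactor
  set f := optScale η s
  set f' := optScale η s'
  have hpos : 0 < f + f' - η := by linarith
  have e1 : f'⁻¹ - f⁻¹ = (f - f') / (f * f') := by field_simp
  have e2 : f - f' = (s - s') * ((s + s') / (2 * (f + f' - η))) := by
    field_simp
    linear_combination 2 * h
  have h3 : 0 ≤ (s + s') / (2 * (f + f' - η)) := by positivity
  rw [e1, abs_div, abs_of_pos (mul_pos hf hf'), e2, abs_mul, abs_of_nonneg h3]
  field_simp

/-! ### Strict convexity of the contribution of a group -/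

/-- The convexity defect of `‖w‖² / (2 t)` is itself a square, so equality in the convexity
inequality forces `t w = s w'`. -/
theorem sq_norm_combo {H : Type*} [NormedAddCommGroup H] [InnerProductSpace ℝ H] (w w' : H)
    {s t a b : ℝ} (hs : 0 < s) (ht : 0 < t) (ha : 0 < a) (hb : 0 < b) :
    ‖a • w + b • w'‖ ^ 2 / (2 * (a * s + b * t))
      + a * b * ‖t • w - s • w'‖ ^ 2 / (2 * (s * t * (a * s + b * t)))
      = a * (‖w‖ ^ 2 / (2 * s)) + b * (‖w'‖ ^ 2 / (2 * t)) := by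
  rw [norm_add_sq_real, norm_sub_sq_real]
  simp only [norm_smul, inner_smul_left, inner_smul_right, mul_pow, Real.norm_eq_abs, sq_abs,
    conj_trivial]
  have : 0 < a * s + b * t := by positivity
  field_simp
  ring

theorem strictConvexOn_groupTerm {H : Type*} [NormedAddCommGroup H] [InnerProductSpace ℝ H]
    {η : ℝ} (hη : 0 < η) :
    StrictConvexOn ℝ {p : H × ℝ | 0 < p.2} fun p => groupTerm η ‖p.1‖ p.2 := by
  refine ⟨(convex_Ioi (0 : ℝ)).linear_preimage (LinearMap.snd ℝ H ℝ), ?_⟩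
  rintro ⟨w, s⟩ (hs : 0 < s) ⟨w', t⟩ (ht : 0 < t) hne a b ha hb hab
  have hc := sq_norm_combo w w' hs ht ha hb
  simp only [groupTerm, Prod.smul_mk, Prod.mk_add_mk, smul_eq_mul] at *
  have hst : 0 < a * s + b * t := by positivity
  -- For equal scales the square defect is positive; for different scales the strictness comes from
  -- `log`.
  by_cases h : s = t
  · subst h
    have hw : w ≠ w' := fun e => hne (by rw [e])
    have hpos : 0 < ‖s • w - s • w'‖ := by
      rw [← smul_sub, norm_smul]
      exact mul_pos (norm_pos_iff.2 hs.ne') (norm_pos_iff.2 (sub_ne_zero.2 hw))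
    have : 0 < a * b * ‖s • w - s • w'‖ ^ 2 / (2 * (s * s * (a * s + b * s))) := by positivity
    have e : Real.log (a * s + b * s) = a * Real.log s + b * Real.log s := by
      rw [← add_mul, ← add_mul, hab, one_mul, one_mul]
    rw [e]
    linarith
  · have hl := strictConcaveOn_log_Ioi.2 hs ht h ha hb hab
    simp only [smul_eq_mul] at hl
    have := mul_lt_mul_of_pos_left hl hη
    have : 0 ≤ a * b * ‖t • w - s • w'‖ ^ 2 / (2 * (s * t * (a * s + b * t))) := by positivity
    linarith

/-! ### Convergence of a descent iteration -/

/-- At a cluster point `x` both `F x` and `F (T x)` equal the limit of the decreasing values, so `x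
= z`; in a compact set a single cluster point is the limit. -/
theorem tendsto_iterate_of_descent {X : Type*} [TopologicalSpace X] {F : X → ℝ} {T : X → X}
    (hF : Continuous F) (hT : Continuous T) {x₀ z : X}
    (hK : IsCompact {x | F x ≤ F x₀}) (hdesc : ∀ x, F (T x) ≤ F x)
    (hfix : ∀ x, F (T x) = F x → x = z) :
    Tendsto (fun l => T^[l] x₀) atTop (𝓝 z) := by
  have hanti : Antitone fun l => F (T^[l] x₀) := antitone_nat_of_succ_le fun l => by
    rw [Function.iterate_succ_apply']
    exact hdesc _
  have hmem : ∀ l, T^[l] x₀ ∈ {x | F x ≤ F x₀} := fun l => hanti (Nat.zero_le l)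
  obtain ⟨B, hB⟩ := (hK.image hF).bddBelow
  have hbdd : BddBelow (Set.range fun l => F (T^[l] x₀)) :=
    ⟨B, by rintro _ ⟨l, rfl⟩; exact hB ⟨_, hmem l, rfl⟩⟩
  have hlim := tendsto_atTop_ciInf hanti hbdd
  refine hK.tendsto_nhds_of_unique_mapClusterPt (Eventually.of_forall hmem) fun x _ hx => ?_
  have h1 : F x = ⨅ l, F (T^[l] x₀) :=
    eq_of_nhds_neBot ((hx.continuousAt_comp hF.continuousAt).neBot.mono (inf_le_inf_left _ hlim))
  have h2 : F (T x) = ⨅ l, F (T^[l] x₀) :=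
    eq_of_nhds_neBot ((hx.continuousAt_comp (hF.comp hT).continuousAt).neBot.mono
      (inf_le_inf_left _ (by simpa [Tendsto, Function.comp_def, ← Function.iterate_succ_apply'] using
        (tendsto_add_atTop_iff_nat 1).2 hlim)))
  exact hfix x (h2.trans h1.symm)

/-! ### The alternating minimization of a convex group-sparse energy -/

section Abstract

variable {E V ι : Type*} [NormedAddCommGroup E] [NormedSpace ℝ E]
  [NormedAddCommGroup V] [InnerProductSpace ℝ V] {H : ι → Type*}
  [∀ j, NormedAddCommGroup (H j)] [∀ j, InnerProductSpace ℝ (H j)]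

/-- The optimal scales of `u`. -/
noncomputable def scales (W : ∀ j, E →ₗ[ℝ] H j) (η : ℝ) (u : E) (j : ι) : ℝ :=
  optScale η ‖W j u‖

variable {G : E →ₗ[ℝ] V} {y : V} {W : ∀ j, E →ₗ[ℝ] H j} {a c η : ℝ}

theorem scales_pos (hη : 0 < η) (u : E) (j : ι) : 0 < scales W η u j := optScale_pos hη _

theorem continuous_scales [FiniteDimensional ℝ E] : Continuous (scales W η) :=
  continuous_pi fun j =>
    (continuous_optScale η).comp (W j).continuous_of_finiteDimensional.norm

variable [Fintype ι]

/-- The objective `a ‖y - G u‖² + c ∑ⱼ (‖Wⱼ u‖² / (2 θⱼ) + θⱼ - η log θⱼ)`. -/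
noncomputable def energy (G : E →ₗ[ℝ] V) (y : V) (W : ∀ j, E →ₗ[ℝ] H j) (a c η : ℝ)
    (p : E × (ι → ℝ)) : ℝ :=
  a * ‖y - G p.1‖ ^ 2 + c * ∑ j, groupTerm η ‖W j p.1‖ (p.2 j)

/-- The normal equation for the minimizer `u` of the energy with fixed scales `θ`. -/
def IsStationary (G : E →ₗ[ℝ] V) (y : V) (W : ∀ j, E →ₗ[ℝ] H j) (a c : ℝ)
    (θ : ι → ℝ) (u : E) : Prop :=
  ∀ v, 2 * a * inner ℝ (G u - y) (G v) + c * ∑ j, inner ℝ (W j u) (W j v) / θ j = 0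

theorem convexOn_misfit (ha : 0 ≤ a) :
    ConvexOn ℝ Set.univ fun u : E => a * ‖y - G u‖ ^ 2 := by
  have h : ConvexOn ℝ Set.univ fun v : V => ‖v‖ ^ 2 :=
    (convexOn_norm convex_univ).pow (fun _ _ => norm_nonneg _) 2
  refine ⟨convex_univ, fun u _ v _ s t hs ht hst => ?_⟩
  have e : y - G (s • u + t • v) = s • (y - G u) + t • (y - G v) := by
    simp only [map_add, map_smul, smul_sub]
    nth_rw 1 [← one_smul ℝ y, ← hst, add_smul]
    abel
  have := mul_le_mul_of_nonneg_left
    (h.2 (Set.mem_univ (y - G u)) (Set.mem_univ (y - G v)) hs ht hst) ha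
  simp only [smul_eq_mul] at this ⊢
  rw [e]
  linarith

/-- The misfit is only convex, as `G` may have a kernel. Strictness comes from one group whose pair
`(W j u, θ j)` changes, which joint injectivity provides. -/
theorem strictConvexOn_energy (hW : ∀ u, (∀ j, W j u = 0) → u = 0) (ha : 0 ≤ a) (hc : 0 < c)
    (hη : 0 < η) :
    StrictConvexOn ℝ {p : E × (ι → ℝ) | ∀ j, 0 < p.2 j} (energy G y W a c η) := by
  refine ⟨?_, ?_⟩
  · intro p hp q hq s t hs ht hst j
    exact (convex_Ioi (0 : ℝ)) (hp j) (hq j) hs ht hst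
  · rintro ⟨u, θ⟩ hθ ⟨v, τ⟩ hτ hne s t hs ht hst
    have hm := (convexOn_misfit (G := G) (y := y) ha).2 (Set.mem_univ u) (Set.mem_univ v)
      hs.le ht.le hst
    have hex : ∃ j, (W j u, θ j) ≠ (W j v, τ j) := by
      by_contra! h
      refine hne (Prod.ext ?_ (funext fun j => (Prod.ext_iff.1 (h j)).2))
      refine sub_eq_zero.1 (hW _ fun j => ?_)
      rw [map_sub]
      exact sub_eq_zero.2 (Prod.ext_iff.1 (h j)).1
    have hle : ∀ j, groupTerm η ‖W j (s • u + t • v)‖ (s * θ j + t * τ j)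
        ≤ s * groupTerm η ‖W j u‖ (θ j) + t * groupTerm η ‖W j v‖ (τ j) := fun j => by
      have := (strictConvexOn_groupTerm (H := H j) hη).convexOn.2
        (x := (W j u, θ j)) (hθ j) (y := (W j v, τ j)) (hτ j) hs.le ht.le hst
      simpa using this
    obtain ⟨j₀, hj₀⟩ := hex
    have hlt : groupTerm η ‖W j₀ (s • u + t • v)‖ (s * θ j₀ + t * τ j₀)
        < s * groupTerm η ‖W j₀ u‖ (θ j₀) + t * groupTerm η ‖W j₀ v‖ (τ j₀) := by
      have := (strictConvexOn_groupTerm (H := H j₀) hη).2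
        (x := (W j₀ u, θ j₀)) (hθ j₀) (y := (W j₀ v, τ j₀)) (hτ j₀) hj₀ hs ht hst
      simpa using this
    have hsum := Finset.sum_lt_sum (fun j _ => hle j) ⟨j₀, Finset.mem_univ _, hlt⟩
    rw [Finset.sum_add_distrib, ← Finset.mul_sum, ← Finset.mul_sum] at hsum
    have := mul_lt_mul_of_pos_left hsum hc
    simp only [energy, Prod.smul_mk, Prod.mk_add_mk, smul_eq_mul, Pi.add_apply, Pi.smul_apply]
      at hm ⊢
    linarith

/-! ### Exact minimization in each variable -/

theorem energy_scales_le (hc : 0 ≤ c) (hη : 0 < η) (u : E) {θ : ι → ℝ} (hθ : ∀ j, 0 < θ j) :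
    energy G y W a c η (u, scales W η u) ≤ energy G y W a c η (u, θ) := by
  unfold energy
  gcongr with j
  exact groupTerm_optScale_le hη _ (hθ j)

theorem misfit_eq (u v : E) :
    a * ‖y - G v‖ ^ 2 = a * ‖y - G u‖ ^ 2 + 2 * a * inner ℝ (G u - y) (G (v - u))
      + a * ‖G (v - u)‖ ^ 2 := by
  have e : y - G v = (y - G u) - G (v - u) := by rw [map_sub]; abel
  have e2 : G u - y = -(y - G u) := by abel
  rw [e, norm_sub_sq_real, e2, inner_neg_left]
  ring

/-- The decrease of the energy in the minimization over `u` with fixed scales. -/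
theorem IsStationary.energy_eq {θ : ι → ℝ} {u : E} (hu : IsStationary G y W a c θ u) (v : E) :
    energy G y W a c η (v, θ) = energy G y W a c η (u, θ) + a * ‖G (v - u)‖ ^ 2
      + c * ∑ j, ‖W j (v - u)‖ ^ 2 / (2 * θ j) := by
  have h := hu (v - u)
  have hs : ∀ j, groupTerm η ‖W j v‖ (θ j) = groupTerm η ‖W j u‖ (θ j)
      + (inner ℝ (W j u) (W j (v - u)) / θ j + ‖W j (v - u)‖ ^ 2 / (2 * θ j)) := fun j => by
    have e : W j v = W j u + W j (v - u) := by rw [map_sub]; abel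
    unfold groupTerm
    rw [e, norm_add_sq_real]
    ring
  have hm := misfit_eq (G := G) (y := y) (a := a) u v
  simp only [energy]
  rw [Finset.sum_congr rfl fun j _ => hs j, Finset.sum_add_distrib, Finset.sum_add_distrib, hm]
  linarith

theorem IsStationary.energy_le (ha : 0 ≤ a) (hc : 0 ≤ c) {θ : ι → ℝ} (hθ : ∀ j, 0 < θ j)
    {u : E} (hu : IsStationary G y W a c θ u) (v : E) :
    energy G y W a c η (u, θ) ≤ energy G y W a c η (v, θ) := by
  rw [hu.energy_eq v, add_assoc]
  have : 0 ≤ ∑ j, ‖W j (v - u)‖ ^ 2 / (2 * θ j) :=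
    Finset.sum_nonneg fun j _ => div_nonneg (sq_nonneg _) (by linarith [hθ j])
  exact le_add_of_nonneg_right (by positivity)

theorem IsStationary.eq_of_energy_le (hW : ∀ u, (∀ j, W j u = 0) → u = 0) (ha : 0 ≤ a)
    (hc : 0 < c) {θ : ι → ℝ} (hθ : ∀ j, 0 < θ j)
    {u v : E} (hu : IsStationary G y W a c θ u)
    (h : energy G y W a c η (v, θ) ≤ energy G y W a c η (u, θ)) : v = u := by
  rw [hu.energy_eq v] at h
  have hnn : ∀ j ∈ Finset.univ, 0 ≤ ‖W j (v - u)‖ ^ 2 / (2 * θ j) :=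
    fun j _ => div_nonneg (sq_nonneg _) (by linarith [hθ j])
  have h1 := Finset.sum_nonneg hnn
  have h2 : 0 ≤ a * ‖G (v - u)‖ ^ 2 := by positivity
  have h3 : c * ∑ j, ‖W j (v - u)‖ ^ 2 / (2 * θ j) ≤ 0 := by linarith
  have h4 : ∑ j, ‖W j (v - u)‖ ^ 2 / (2 * θ j) = 0 := le_antisymm (by nlinarith) h1
  refine sub_eq_zero.1 (hW _ fun j => ?_)
  have h5 := (Finset.sum_eq_zero_iff_of_nonneg hnn).1 h4 j (Finset.mem_univ j)
  simpa [(hθ j).ne'] using h5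

/-- The contribution of a group lies above its tangent plane at a pair with optimal scale. -/
theorem groupTerm_tangent_le {H : Type*} [NormedAddCommGroup H] [InnerProductSpace ℝ H]
    (hη : 0 < η) (w w' : H) {t : ℝ} (ht : 0 < t) :
    groupTerm η ‖w‖ (optScale η ‖w‖) + inner ℝ w (w' - w) / optScale η ‖w‖
      ≤ groupTerm η ‖w'‖ t := by
  have hf := optScale_pos hη ‖w‖
  have hsq := optScale_sq η ‖w‖
  set f := optScale η ‖w‖
  have hlog := mul_log_le hη ht hf
  have h0 : 0 ≤ ‖f • w' - t • w‖ ^ 2 / (2 * (f ^ 2 * t)) := by positivity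
  -- The derivative in the scale vanishes at `f`, so the tangent plane has no `t` term; with the
  -- tangent to `log` at `f`, the remaining gap is a square.
  have key : ‖w'‖ ^ 2 / (2 * t) + t - (‖w‖ ^ 2 / (2 * f) + f) - inner ℝ w (w' - w) / f
      - η * (t - f) / f = ‖f • w' - t • w‖ ^ 2 / (2 * (f ^ 2 * t)) := by
    rw [norm_sub_sq_real, inner_sub_right, real_inner_self_eq_norm_sq]
    simp only [norm_smul, inner_smul_left, inner_smul_right, mul_pow, Real.norm_eq_abs, sq_abs,
      conj_trivial, real_inner_comm w w']
    have hw : ‖w‖ ^ 2 = 2 * (f ^ 2 - η * f) := by linarith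
    rw [hw]
    field_simp
    ring
  unfold groupTerm
  linarith

/-- Summing the tangent plane bounds, the linear terms of the groups and of the misfit cancel by the
normal equation. -/
theorem IsStationary.isMinOn (ha : 0 ≤ a) (hc : 0 ≤ c) (hη : 0 < η) {u : E}
    (hu : IsStationary G y W a c (scales W η u) u) :
    IsMinOn (energy G y W a c η) {p | ∀ j, 0 < p.2 j} (u, scales W η u) := by
  rintro ⟨v, θ⟩ hθ
  have h := hu (v - u)
  have hm := misfit_eq (G := G) (y := y) (a := a) u v
  have h0 : 0 ≤ a * ‖G (v - u)‖ ^ 2 := by positivity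
  have hs := Finset.sum_le_sum fun j (_ : j ∈ Finset.univ) =>
    groupTerm_tangent_le hη (W j u) (W j v) (hθ j)
  rw [Finset.sum_add_distrib] at hs
  have hs' := mul_le_mul_of_nonneg_left hs hc
  simp only [map_sub (W _), scales] at h
  simp only [Set.mem_ofPred_eq, energy, scales]
  linarith

/-! ### Existence of a minimizer -/

theorem continuous_energy_scales [FiniteDimensional ℝ E] (hη : 0 < η) :
    Continuous fun u => energy G y W a c η (u, scales W η u) := by
  have hG := G.continuous_of_finiteDimensional
  have hWc := fun j => (W j).continuous_of_finiteDimensional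
  have hs : ∀ j, Continuous fun u => scales W η u j := fun j =>
    (continuous_apply j).comp continuous_scales
  unfold energy groupTerm
  refine Continuous.add (by fun_prop) (continuous_const.mul (continuous_finsetSum _ fun j _ => ?_))
  refine ((Continuous.div (by fun_prop) (by fun_prop) fun u => ?_).add (hs j)).sub
    (continuous_const.mul ((hs j).log fun u => (scales_pos hη u j).ne'))
  exact (mul_pos two_pos (scales_pos hη u j)).ne'

theorem isCompact_energy_scales_le [FiniteDimensional ℝ E]
    (hW : ∀ u, (∀ j, W j u = 0) → u = 0) (ha : 0 ≤ a) (hc : 0 < c) (hη : 0 < η) (M : ℝ) :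
    IsCompact {u | energy G y W a c η (u, scales W η u) ≤ M} := by
  have : ProperSpace E := FiniteDimensional.proper ℝ E
  refine Metric.isCompact_of_isClosed_isBounded
    (isClosed_le (continuous_energy_scales hη) continuous_const) ?_
  let K := η * Real.log (2 * η)
  -- The sublevel condition bounds half the sum of the scales by `M / c + card ι * K`, and `‖W j u‖`
  -- is at most twice its scale: hence the 4.
  let R := 4 * (M / c + Fintype.card ι * K)
  obtain ⟨B, -, hB⟩ := (LinearMap.pi W).injective_iff_antilipschitz.1 <| by
    rw [injective_iff_map_eq_zero]
    exact fun u hu => hW u fun j => congrFun hu j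
  refine (hB.isBounded_preimage (Metric.isBounded_closedBall (x := 0) (r := |R|))).subset ?_
  intro u (hu : _ ≤ M)
  rw [Set.mem_preimage, mem_closedBall_zero_iff, pi_norm_le_iff_of_nonneg (abs_nonneg _)]
  intro j
  refine le_trans ?_ (le_abs_self R)
  have h1 : ∑ j, (scales W η u j / 2 - K) ≤ M / c := by
    rw [le_div_iff₀' hc]
    refine le_trans (mul_le_mul_of_nonneg_left (Finset.sum_le_sum fun j _ =>
      half_sub_le_groupTerm hη ‖W j u‖ (scales_pos hη u j)) hc.le) (le_trans ?_ hu)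
    exact le_add_of_nonneg_left (by positivity)
  rw [Finset.sum_sub_distrib, ← Finset.sum_div] at h1
  simp only [Finset.sum_const, Finset.card_univ, nsmul_eq_mul] at h1
  have h2 : scales W η u j ≤ ∑ j, scales W η u j :=
    Finset.single_le_sum (fun j _ => (scales_pos hη u j).le) (Finset.mem_univ j)
  have h3 : ‖W j u‖ ≤ 2 * scales W η u j := le_two_mul_optScale hη _
  simp only [LinearMap.pi_apply, R]
  linarith

theorem exists_isMinOn_energy_scales [FiniteDimensional ℝ E]
    (hW : ∀ u, (∀ j, W j u = 0) → u = 0) (ha : 0 ≤ a) (hc : 0 < c) (hη : 0 < η) :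
    ∃ u, IsMinOn (fun u => energy G y W a c η (u, scales W η u)) Set.univ u := by
  obtain ⟨u, -, hu⟩ := (isCompact_energy_scales_le (G := G) (y := y) hW ha hc hη
    (energy G y W a c η (0, scales W η 0))).exists_isMinOn ⟨0, le_refl (energy G y W a c η (0, scales W η 0))⟩
    (continuous_energy_scales (G := G) (y := y) (W := W) hη).continuousOn
  refine ⟨u, fun v _ => ?_⟩
  by_cases hv : energy G y W a c η (v, scales W η v) ≤ energy G y W a c η (0, scales W η 0)
  · exact hu hv
  · exact (hu (le_refl (energy G y W a c η (0, scales W η 0)))).trans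
      (not_le.1 hv).le

theorem isMinOn_energy_of_reduced (hc : 0 ≤ c) (hη : 0 < η) {u : E}
    (hu : IsMinOn (fun u => energy G y W a c η (u, scales W η u)) Set.univ u) :
    IsMinOn (energy G y W a c η) {p | ∀ j, 0 < p.2 j} (u, scales W η u) := by
  rintro ⟨v, θ⟩ hθ
  exact (hu (Set.mem_univ v)).trans (energy_scales_le hc hη v hθ)

/-! ### The alternating iteration -/

/-- The minimizer has optimal scales. -/
theorem eq_scales_of_isMinOn (hW : ∀ u, (∀ j, W j u = 0) → u = 0) (ha : 0 ≤ a) (hc : 0 < c)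
    (hη : 0 < η) {u : E} {θ : ι → ℝ} (hθ : ∀ j, 0 < θ j)
    (hmin : IsMinOn (energy G y W a c η) {p | ∀ j, 0 < p.2 j} (u, θ)) : θ = scales W η u := by
  have h2 : IsMinOn (energy G y W a c η) {p | ∀ j, 0 < p.2 j} (u, scales W η u) :=
    fun p hp => (energy_scales_le hc.le hη u hθ).trans (hmin hp)
  exact congrArg Prod.snd ((strictConvexOn_energy (G := G) (y := y) hW ha hc hη).eq_of_isMinOn
    hmin h2 hθ (scales_pos hη u))

theorem tendsto_of_iteration [FiniteDimensional ℝ E] (hW : ∀ u, (∀ j, W j u = 0) → u = 0)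
    (ha : 0 ≤ a) (hc : 0 < c) (hη : 0 < η) {U : (ι → ℝ) → E}
    (hU : ∀ θ, (∀ j, 0 < θ j) → IsStationary G y W a c θ (U θ))
    (hUc : ContinuousOn U {θ | ∀ j, 0 < θ j}) {uhat : E}
    (hmin : IsMinOn (energy G y W a c η) {p | ∀ j, 0 < p.2 j} (uhat, scales W η uhat)) (u₀ : E) :
    Tendsto (fun l => (fun u => U (scales W η u))^[l] u₀) atTop (𝓝 uhat) := by
  have hstep : ∀ u, energy G y W a c η (U (scales W η u), scales W η (U (scales W η u)))
      ≤ energy G y W a c η (U (scales W η u), scales W η u) := fun u =>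
    energy_scales_le hc.le hη _ (scales_pos hη u)
  refine tendsto_iterate_of_descent (continuous_energy_scales (G := G) (y := y) (a := a) (c := c) hη)
    (hUc.comp_continuous (continuous_scales (W := W)) (scales_pos (W := W) hη))
    (isCompact_energy_scales_le hW ha hc hη _) (fun u => ?_) fun u hu => ?_
  · exact (hstep u).trans ((hU _ (scales_pos hη u)).energy_le ha hc.le (scales_pos hη u) u)
  · have hst := hU _ (scales_pos (W := W) hη u)
    have hfix := hst.eq_of_energy_le hW ha hc (scales_pos hη u) (hu.symm.le.trans (hstep u))
    rw [← hfix] at hst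
    exact congrArg Prod.fst ((strictConvexOn_energy (G := G) (y := y) hW ha hc hη).eq_of_isMinOn
      (hst.isMinOn ha hc.le hη) hmin (scales_pos hη u) (scales_pos hη uhat))

/-- No differentiation is needed: `U θ` solves the normal equation and is the only minimizer for the
scales `θ`, so it coincides with `u`. -/
theorem isStationary_of_isMinOn (hW : ∀ u, (∀ j, W j u = 0) → u = 0) (ha : 0 ≤ a) (hc : 0 < c)
    {U : (ι → ℝ) → E} (hU : ∀ θ, (∀ j, 0 < θ j) → IsStationary G y W a c θ (U θ))
    {u : E} {θ : ι → ℝ} (hθ : ∀ j, 0 < θ j)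
    (hmin : IsMinOn (energy G y W a c η) {p | ∀ j, 0 < p.2 j} (u, θ)) :
    IsStationary G y W a c θ u := by
  have hst := hU θ hθ
  have := hst.eq_of_energy_le (η := η) hW ha hc hθ (hmin (show (U θ, θ) ∈ _ from hθ))
  rwa [← this] at hst

/-- Comparison of the solutions of two normal equations. -/
theorem sum_sq_le_of_isStationary (ha : 0 ≤ a) (hc : 0 < c) {θ θ' : ι → ℝ} {u u' : E}
    (hu : IsStationary G y W a c θ u) (hu' : IsStationary G y W a c θ' u') :
    ∑ j, ‖W j (u - u')‖ ^ 2 / θ j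
      ≤ ∑ j, |(θ' j)⁻¹ - (θ j)⁻¹| * ‖W j u'‖ * ‖W j (u - u')‖ := by
  have h := hu (u - u')
  have h' := hu' (u - u')
  have hG : inner ℝ (G u - y) (G (u - u')) - inner ℝ (G u' - y) (G (u - u'))
      = ‖G (u - u')‖ ^ 2 := by
    rw [← inner_sub_left, sub_sub_sub_cancel_right, ← map_sub, real_inner_self_eq_norm_sq]
  have hj : ∀ j, inner ℝ (W j u) (W j (u - u')) / θ j - inner ℝ (W j u') (W j (u - u')) / θ' j
      = ‖W j (u - u')‖ ^ 2 / θ j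
        - ((θ' j)⁻¹ - (θ j)⁻¹) * inner ℝ (W j u') (W j (u - u')) := fun j => by
    have e : W j u = W j (u - u') + W j u' := by rw [map_sub]; abel
    rw [← real_inner_self_eq_norm_sq]
    nth_rw 1 [e]
    rw [inner_add_left]
    ring
  have hsum := Finset.sum_congr (rfl : Finset.univ = Finset.univ) fun j _ => hj j
  rw [Finset.sum_sub_distrib, Finset.sum_sub_distrib] at hsum
  have h0 : 0 ≤ a * ‖G (u - u')‖ ^ 2 := by positivity
  have hle : ∑ j, ((θ' j)⁻¹ - (θ j)⁻¹) * inner ℝ (W j u') (W j (u - u'))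
      ≤ ∑ j, |(θ' j)⁻¹ - (θ j)⁻¹| * ‖W j u'‖ * ‖W j (u - u')‖ := by
    refine Finset.sum_le_sum fun j _ => (le_abs_self _).trans ?_
    rw [abs_mul, mul_assoc]
    exact mul_le_mul_of_nonneg_left (abs_real_inner_le_norm _ _) (abs_nonneg _)
  -- Subtracting the normal equations tested with `u - u'` leaves `2 a ‖G (u - u')‖²`, which has a
  -- good sign and is dropped.
  have hc' : c * (∑ j, ‖W j (u - u')‖ ^ 2 / θ j
      - ∑ j, ((θ' j)⁻¹ - (θ j)⁻¹) * inner ℝ (W j u') (W j (u - u'))) ≤ 0 := by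
    rw [← hsum]
    linear_combination h - h' - 2 * a * hG + 2 * h0
  have := nonpos_of_mul_nonpos_right hc' hc
  linarith

/-- Near `û`, one step of the iteration contracts the norm weighted with the limiting scales. -/
theorem exists_eventually_contraction [FiniteDimensional ℝ E] (ha : 0 ≤ a) (hc : 0 < c)
    (hη : 0 < η) {U : (ι → ℝ) → E}
    (hU : ∀ θ, (∀ j, 0 < θ j) → IsStationary G y W a c θ (U θ)) {uhat : E}
    (hst : IsStationary G y W a c (scales W η uhat) uhat) :
    ∃ μ : ℝ, 0 ≤ μ ∧ μ < 1 ∧ ∀ᶠ u in 𝓝 uhat,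
      Real.sqrt (∑ j, ‖W j (U (scales W η u) - uhat)‖ ^ 2 / scales W η uhat j)
        ≤ μ * Real.sqrt (∑ j, ‖W j (u - uhat)‖ ^ 2 / scales W η uhat j) := by
  -- Room is left between the limiting factors and 1; `0 ≤ r` is asked separately to cover an empty
  -- index set.
  have hr : ∀ᶠ r in 𝓝[<] (1 : ℝ), 0 ≤ r ∧ r < 1 ∧
      ∀ j, updateFactor η ‖W j uhat‖ ‖W j uhat‖ < r := by
    refine (Filter.Eventually.filter_mono nhdsWithin_le_nhds (eventually_ge_nhds one_pos)).and
      (eventually_mem_nhdsWithin.and (eventually_all.2 fun j => ?_))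
    exact Filter.Eventually.filter_mono nhdsWithin_le_nhds
      (eventually_gt_nhds (updateFactor_self_lt_one hη _))
  obtain ⟨r, hr0, hr1, hr⟩ := hr.exists
  -- The number `q`, strictly between `r` and 1, pays for exchanging the current weights with the
  -- limiting ones near `uhat`.
  let q := (1 + r) / 2
  have hq0 : 0 < q := by positivity
  have hrq : r < q := by simp only [q]; linarith
  have hq1 : q < 1 := by simp only [q]; linarith
  refine ⟨r / q, by positivity, (div_lt_one hq0).2 hrq, ?_⟩
  have hWn : ∀ j, Continuous fun u => ‖W j u‖ := fun j =>
    (W j).continuous_of_finiteDimensional.norm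
  have hev1 : ∀ᶠ u in 𝓝 uhat, ∀ j, updateFactor η ‖W j u‖ ‖W j uhat‖ < r :=
    eventually_all.2 fun j =>
      ((continuous_updateFactor hη ‖W j uhat‖).comp (hWn j)).continuousAt.eventually_lt_const (hr j)
  have hev2 : ∀ᶠ u in 𝓝 uhat, ∀ j, q * scales W η u j < scales W η uhat j := by
    refine eventually_all.2 fun j => ?_
    have : Continuous fun u => q * scales W η u j :=
      continuous_const.mul ((continuous_apply j).comp (continuous_scales (W := W)))
    refine this.continuousAt.eventually_lt_const ?_
    nlinarith [scales_pos (W := W) hη uhat j]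
  filter_upwards [hev1, hev2] with u h1 h2
  have hcmp := sum_sq_le_of_isStationary ha hc (hU _ (scales_pos (W := W) hη u)) hst
  set v := U (scales W η u)
  have hpos := scales_pos (W := W) hη uhat
  have hlow : q * ∑ j, ‖W j (v - uhat)‖ ^ 2 / scales W η uhat j
      ≤ ∑ j, ‖W j (v - uhat)‖ ^ 2 / scales W η u j := by
    rw [Finset.mul_sum]
    refine Finset.sum_le_sum fun j _ => ?_
    rw [← mul_div_assoc, div_le_div_iff₀ (hpos j) (scales_pos hη u j)]
    nlinarith [h2 j, sq_nonneg ‖W j (v - uhat)‖]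
  have hup : ∀ j, |(scales W η uhat j)⁻¹ - (scales W η u j)⁻¹| * ‖W j uhat‖ * ‖W j (v - uhat)‖
      ≤ r * ((‖W j (u - uhat)‖ / Real.sqrt (scales W η uhat j))
          * (‖W j (v - uhat)‖ / Real.sqrt (scales W η uhat j))) := fun j => by
    have e := abs_inv_optScale_sub_mul hη (norm_nonneg (W j u)) (norm_nonneg (W j uhat))
    rw [div_mul_div_comm, Real.mul_self_sqrt (hpos j).le]
    change |(optScale η ‖W j uhat‖)⁻¹ - (optScale η ‖W j u‖)⁻¹| * _ * _ ≤ _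
    rw [e]
    have hn : |‖W j u‖ - ‖W j uhat‖| ≤ ‖W j (u - uhat)‖ := by
      rw [map_sub]
      exact abs_norm_sub_norm_le _ _
    have : updateFactor η ‖W j u‖ ‖W j uhat‖ * |‖W j u‖ - ‖W j uhat‖| ≤ r * ‖W j (u - uhat)‖ :=
      mul_le_mul (h1 j).le hn (abs_nonneg _) hr0
    calc _ ≤ r * ‖W j (u - uhat)‖ / optScale η ‖W j uhat‖ * ‖W j (v - uhat)‖ := by
          have := hpos j
          unfold scales at this
          gcongr
      _ = _ := by unfold scales; ring
  have hcs := Real.sum_mul_le_sqrt_mul_sqrt Finset.univ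
    (fun j => ‖W j (u - uhat)‖ / Real.sqrt (scales W η uhat j))
    (fun j => ‖W j (v - uhat)‖ / Real.sqrt (scales W η uhat j))
  simp only [div_pow, Real.sq_sqrt (hpos _).le] at hcs
  have hfin := (hlow.trans hcmp).trans (Finset.sum_le_sum fun j _ => hup j)
  rw [← Finset.mul_sum] at hfin
  have hnn : 0 ≤ ∑ j, ‖W j (v - uhat)‖ ^ 2 / scales W η uhat j :=
    Finset.sum_nonneg fun j _ => div_nonneg (sq_nonneg _) (hpos j).le
  have hsq := Real.mul_self_sqrt hnn
  set N := Real.sqrt (∑ j, ‖W j (v - uhat)‖ ^ 2 / scales W η uhat j) with hN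
  set N' := Real.sqrt (∑ j, ‖W j (u - uhat)‖ ^ 2 / scales W η uhat j)
  rw [← hsq] at hfin
  have hN0 : 0 ≤ N := Real.sqrt_nonneg _
  have hN0' : 0 ≤ N' := Real.sqrt_nonneg _
  have hmain : q * (N * N) ≤ r * (N' * N) := hfin.trans (mul_le_mul_of_nonneg_left hcs hr0)
  rw [div_mul_eq_mul_div, le_div_iff₀' hq0]
  -- One factor `N` cancels from `hmain`; for `N = 0` the claim is trivial.
  rcases hN0.eq_or_lt with h | h
  · rw [← h, mul_zero]
    positivity
  · nlinarith

end Abstract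

/-! ### Matrices of the problem -/

open scoped MatrixOrder in
/-- A linear change of coordinates that turns the form `uᵀ C⁻¹ v` into the Euclidean one. -/
theorem exists_whitening {ι : Type*} [Fintype ι] [DecidableEq ι] {C : Matrix ι ι ℝ}
    (hC : C.PosDef) : ∃ S : (ι → ℝ) →ₗ[ℝ] EuclideanSpace ℝ ι,
      ∀ u v, inner ℝ (S u) (S v) = u ⬝ᵥ (C⁻¹ *ᵥ v) := by
  obtain ⟨B, hB⟩ := CStarAlgebra.nonneg_iff_eq_star_mul_self.1 hC.inv.posSemidef.nonneg
  refine ⟨(WithLp.linearEquiv 2 ℝ (ι → ℝ)).symm.toLinearMap ∘ₗ B.mulVecLin, fun u v => ?_⟩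
  change inner ℝ (WithLp.toLp 2 (B *ᵥ u)) (WithLp.toLp 2 (B *ᵥ v)) = _
  rw [EuclideanSpace.inner_toLp_toLp, hB, star_trivial, dotProduct_comm, ← Matrix.mulVec_mulVec,
    Matrix.star_eq_conjTranspose, Matrix.conjTranspose_eq_transpose_of_trivial,
    Matrix.mulVec_transpose, dotProduct_comm u, ← Matrix.dotProduct_mulVec, dotProduct_comm]

theorem dotProduct_blockDiagonal'_mulVec {ι : Type*} [Fintype ι] [DecidableEq ι] {m : ι → Type*}
    [∀ j, Fintype (m j)] (N : ∀ j, Matrix (m j) (m j) ℝ) (u v : (Σ j, m j) → ℝ) :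
    u ⬝ᵥ (Matrix.blockDiagonal' N *ᵥ v)
      = ∑ j, (fun i => u ⟨j, i⟩) ⬝ᵥ (N j *ᵥ fun i => v ⟨j, i⟩) := by
  simp only [dotProduct, Matrix.mulVec, Fintype.sum_sigma]
  refine Finset.sum_congr rfl fun j _ => Finset.sum_congr rfl fun i _ => ?_
  congr 1
  rw [Finset.sum_eq_single j (fun j' _ hj' => ?_) (by simp)]
  · simp only [Matrix.blockDiagonal'_apply_eq]
  · exact Finset.sum_eq_zero fun i' _ => by
      rw [Matrix.blockDiagonal'_apply_ne _ _ _ hj'.symm, zero_mul]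

/-! ### Block-diagonal covariance and whitened coordinates -/

section Blocks

variable {d k : ℕ} {g : Fin d → Fin k} {C : (j : Fin k) → Matrix (Group g j) (Group g j) ℝ}

/-- The explicit inverse serves twice: it splits the Mahalanobis form over the groups and shows
continuity in `θ`. -/
theorem blockCov_inv (hC : ∀ j, (C j).PosDef) {θ : Fin k → ℝ} (hθ : ∀ j, 0 < θ j) :
    (blockCov g C θ)⁻¹ = Matrix.reindex (Equiv.sigmaFiberEquiv g) (Equiv.sigmaFiberEquiv g)
      (Matrix.blockDiagonal' fun j => (θ j)⁻¹ • (C j)⁻¹) := by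
  unfold blockCov
  rw [Matrix.inv_reindex]
  congr 1
  refine Matrix.inv_eq_right_inv ?_
  rw [← Matrix.blockDiagonal'_mul, ← Matrix.blockDiagonal'_one]
  congr 1
  funext j
  rw [Matrix.smul_mul, Matrix.mul_smul, smul_smul, mul_inv_cancel₀ (hθ j).ne', one_smul,
    Matrix.mul_nonsing_inv _ ((Matrix.isUnit_iff_isUnit_det _).1 (hC j).isUnit)]
  rfl

theorem dotProduct_blockCov_inv_mulVec (hC : ∀ j, (C j).PosDef) {θ : Fin k → ℝ}
    (hθ : ∀ j, 0 < θ j) (u v : Fin d → ℝ) :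
    u ⬝ᵥ ((blockCov g C θ)⁻¹ *ᵥ v)
      = ∑ j, (groupPart g u j ⬝ᵥ ((C j)⁻¹ *ᵥ groupPart g v j)) / θ j := by
  rw [blockCov_inv hC hθ, Matrix.reindex_apply, Matrix.submatrix_mulVec_equiv,
    ← comp_equiv_dotProduct_comp_equiv _ _ (Equiv.sigmaFiberEquiv g), Function.comp_assoc,
    Equiv.symm_comp_self, Function.comp_id, Equiv.symm_symm, dotProduct_blockDiagonal'_mulVec]
  refine Finset.sum_congr rfl fun j _ => ?_
  rw [Matrix.smul_mulVec, dotProduct_smul, smul_eq_mul, div_eq_inv_mul]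
  rfl

/-- Restriction to a group of coordinates, as a linear map. -/
def groupPartₗ (g : Fin d → Fin k) (j : Fin k) : (Fin d → ℝ) →ₗ[ℝ] (Group g j → ℝ) :=
  LinearMap.funLeft ℝ ℝ Subtype.val

/-- `W` turns the Mahalanobis forms of the groups into Euclidean inner products. -/
def IsWhitening (g : Fin d → Fin k) (C : (j : Fin k) → Matrix (Group g j) (Group g j) ℝ)
    (W : ∀ j, (Fin d → ℝ) →ₗ[ℝ] EuclideanSpace ℝ (Group g j)) : Prop :=
  ∀ j u v, inner ℝ (W j u) (W j v) = groupPart g u j ⬝ᵥ ((C j)⁻¹ *ᵥ groupPart g v j)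

theorem exists_isWhitening (hC : ∀ j, (C j).PosDef) : ∃ W, IsWhitening g C W := by
  choose S hS using fun j => exists_whitening (hC j)
  exact ⟨fun j => S j ∘ₗ groupPartₗ g j, fun j u v => hS j _ _⟩

variable {W : ∀ j, (Fin d → ℝ) →ₗ[ℝ] EuclideanSpace ℝ (Group g j)}

theorem IsWhitening.norm_eq (hW : IsWhitening g C W) (u : Fin d → ℝ) (j : Fin k) :
    mahalanobisNorm (C j) (groupPart g u j) = ‖W j u‖ := by
  rw [norm_eq_sqrt_real_inner, hW]
  rfl

theorem IsWhitening.eq_zero (hW : IsWhitening g C W) (hC : ∀ j, (C j).PosDef) (u : Fin d → ℝ)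
    (hu : ∀ j, W j u = 0) : u = 0 := by
  funext i
  have h := hW (g i) u u
  rw [hu, inner_zero_left] at h
  by_contra hne
  have hpart : groupPart g u (g i) ≠ 0 := fun h0 => hne (congrFun h0 ⟨i, rfl⟩)
  have := (hC (g i)).inv.dotProduct_mulVec_pos hpart
  rw [star_trivial] at this
  exact this.ne h

theorem IsWhitening.thetaOf_eq (hW : IsWhitening g C W) (η : ℝ) (u : Fin d → ℝ) :
    thetaOf g C η u = scales W η u := by
  funext j
  simp only [thetaOf, hW.norm_eq]
  rfl

theorem IsWhitening.dotProduct_eq (hW : IsWhitening g C W) (hC : ∀ j, (C j).PosDef)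
    {θ : Fin k → ℝ} (hθ : ∀ j, 0 < θ j) (u v : Fin d → ℝ) :
    u ⬝ᵥ ((blockCov g C θ)⁻¹ *ᵥ v) = ∑ j, inner ℝ (W j u) (W j v) / θ j := by
  rw [dotProduct_blockCov_inv_mulVec hC hθ]
  exact Finset.sum_congr rfl fun j _ => by rw [hW]

theorem IsWhitening.blockNorm_eq (hW : IsWhitening g C W) (hC : ∀ j, (C j).PosDef)
    {θ : Fin k → ℝ} (hθ : ∀ j, 0 < θ j) (u : Fin d → ℝ) :
    mahalanobisNorm (blockCov g C θ) u = Real.sqrt (∑ j, ‖W j u‖ ^ 2 / θ j) := by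
  unfold mahalanobisNorm
  rw [hW.dotProduct_eq hC hθ]
  simp only [real_inner_self_eq_norm_sq]

/-- The forward map with values in the Euclidean space. -/
def forwardMap {n : ℕ} (A : Matrix (Fin n) (Fin d) ℝ) :
    (Fin d → ℝ) →ₗ[ℝ] EuclideanSpace ℝ (Fin n) :=
  (WithLp.linearEquiv 2 ℝ (Fin n → ℝ)).symm.toLinearMap ∘ₗ A.mulVecLin

variable {n : ℕ} {A : Matrix (Fin n) (Fin d) ℝ} {y : Fin n → ℝ} {lam η : ℝ}

theorem forwardMap_apply (u : Fin d → ℝ) : forwardMap A u = WithLp.toLp 2 (A *ᵥ u) := rfl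

theorem misfit_eq_norm (u : Fin d → ℝ) :
    misfit A y u = 1 / (2 * (n : ℝ)) * ‖WithLp.toLp 2 y - forwardMap A u‖ ^ 2 := rfl

theorem IsWhitening.objJ_eq (hW : IsWhitening g C W) (hC : ∀ j, (C j).PosDef)
    {p : (Fin d → ℝ) × (Fin k → ℝ)} (hp : p ∈ domain d k) :
    objJ A y g C lam η p = energy (forwardMap A) (WithLp.toLp 2 y) W (1 / (2 * (n : ℝ)))
      (lam / Real.sqrt 2) η p := by
  have hnn : 0 ≤ ∑ j, ‖W j p.1‖ ^ 2 / p.2 j :=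
    Finset.sum_nonneg fun j _ => div_nonneg (sq_nonneg _) (hp j).le
  simp only [objJ, energy, groupTerm, misfit_eq_norm, hW.blockNorm_eq hC hp, Real.sq_sqrt hnn,
    add_assoc, add_sub_assoc]
  rw [Finset.sum_add_distrib, mul_add, Finset.mul_sum,
    Finset.mul_sum (f := fun j => ‖W j p.1‖ ^ 2 / (2 * p.2 j))]
  congr 2
  refine Finset.sum_congr rfl fun j _ => ?_
  have := (hp j).ne'
  field_simp

theorem IsWhitening.objF_eq (hW : IsWhitening g C W) (u : Fin d → ℝ) :
    objF A y g C lam η u = energy (forwardMap A) (WithLp.toLp 2 y) W (1 / (2 * (n : ℝ)))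
      (lam / Real.sqrt 2) η (u, scales W η u) := by
  simp only [objF, regR, energy, groupTerm, misfit_eq_norm, hW.norm_eq, hW.thetaOf_eq]
  ring

theorem IsWhitening.isMAP_iff (hW : IsWhitening g C W) (hC : ∀ j, (C j).PosDef)
    {p : (Fin d → ℝ) × (Fin k → ℝ)} :
    IsMAP A y g C lam η p ↔ p ∈ domain d k ∧ IsMinOn (energy (forwardMap A) (WithLp.toLp 2 y) W
      (1 / (2 * (n : ℝ))) (lam / Real.sqrt 2) η) (domain d k) p := by
  refine and_congr_right fun hp => ?_
  simp only [isMinOn_iff]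
  exact forall₂_congr fun q hq => by rw [hW.objJ_eq hC hp, hW.objJ_eq hC hq]

/-- The matrix of the normal equation of the `u`-update. -/
noncomputable def normalMatrix (A : Matrix (Fin n) (Fin d) ℝ) (g : Fin d → Fin k)
    (C : (j : Fin k) → Matrix (Group g j) (Group g j) ℝ) (lam : ℝ) (θ : Fin k → ℝ) :
    Matrix (Fin d) (Fin d) ℝ :=
  (1 / (n : ℝ)) • (Aᵀ * A) + (lam / Real.sqrt 2) • (blockCov g C θ)⁻¹

theorem dotProduct_transpose_mulVec (v : Fin d → ℝ) (w : Fin n → ℝ) :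
    v ⬝ᵥ (Aᵀ *ᵥ w) = inner ℝ (WithLp.toLp 2 w) (forwardMap A v) := by
  rw [forwardMap_apply, EuclideanSpace.inner_toLp_toLp, star_trivial, Matrix.mulVec_transpose,
    dotProduct_comm, ← Matrix.dotProduct_mulVec, dotProduct_comm]

theorem IsWhitening.dotProduct_normalMatrix (hW : IsWhitening g C W) (hC : ∀ j, (C j).PosDef)
    {θ : Fin k → ℝ} (hθ : ∀ j, 0 < θ j) (u v : Fin d → ℝ) :
    v ⬝ᵥ (normalMatrix A g C lam θ *ᵥ u)
      = 1 / (n : ℝ) * inner ℝ (forwardMap A u) (forwardMap A v)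
        + lam / Real.sqrt 2 * ∑ j, inner ℝ (W j u) (W j v) / θ j := by
  rw [normalMatrix, Matrix.add_mulVec, dotProduct_add, Matrix.smul_mulVec, Matrix.smul_mulVec,
    dotProduct_smul, dotProduct_smul, hW.dotProduct_eq hC hθ, ← Matrix.mulVec_mulVec,
    dotProduct_transpose_mulVec]
  simp only [real_inner_comm, smul_eq_mul]
  rfl

/-- A kernel vector makes the quadratic form vanish, hence its penalty part, which is definite
whatever the kernel of `A`. -/
theorem IsWhitening.isUnit_normalMatrix (hW : IsWhitening g C W) (hC : ∀ j, (C j).PosDef)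
    (hlam : 0 < lam) {θ : Fin k → ℝ} (hθ : ∀ j, 0 < θ j) : IsUnit (normalMatrix A g C lam θ) := by
  rw [← Matrix.mulVec_injective_iff_isUnit, ← Matrix.coe_mulVecLin, injective_iff_map_eq_zero]
  intro u hu
  have h := hW.dotProduct_normalMatrix (A := A) (lam := lam) hC hθ u u
  rw [← Matrix.mulVecLin_apply, hu, dotProduct_zero] at h
  simp only [real_inner_self_eq_norm_sq] at h
  have hnn : ∀ j ∈ Finset.univ, 0 ≤ ‖W j u‖ ^ 2 / θ j :=
    fun j _ => div_nonneg (sq_nonneg _) (hθ j).le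
  have h1 := Finset.sum_nonneg hnn
  have h2 : 0 ≤ 1 / (n : ℝ) * ‖forwardMap A u‖ ^ 2 := by positivity
  have hc : 0 < lam / Real.sqrt 2 := by positivity
  have h3 : ∑ j, ‖W j u‖ ^ 2 / θ j = 0 := le_antisymm (by nlinarith) h1
  refine hW.eq_zero hC u fun j => ?_
  have h4 := (Finset.sum_eq_zero_iff_of_nonneg hnn).1 h3 j (Finset.mem_univ j)
  simpa [(hθ j).ne'] using h4

theorem IsWhitening.isStationary_uUpdate (hW : IsWhitening g C W) (hC : ∀ j, (C j).PosDef)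
    (hlam : 0 < lam) {θ : Fin k → ℝ} (hθ : ∀ j, 0 < θ j) :
    IsStationary (forwardMap A) (WithLp.toLp 2 y) W (1 / (2 * (n : ℝ))) (lam / Real.sqrt 2) θ
      (uUpdate A y g C lam θ) := by
  intro v
  have h : normalMatrix A g C lam θ *ᵥ uUpdate A y g C lam θ = (1 / (n : ℝ)) • (Aᵀ *ᵥ y) := by
    change _ *ᵥ ((normalMatrix A g C lam θ)⁻¹ *ᵥ _) = _
    rw [Matrix.mulVec_mulVec, Matrix.mul_nonsing_inv _ ((Matrix.isUnit_iff_isUnit_det _).1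
      (hW.isUnit_normalMatrix hC hlam hθ)), Matrix.one_mulVec]
  have h2 := hW.dotProduct_normalMatrix (A := A) (lam := lam) hC hθ (uUpdate A y g C lam θ) v
  rw [h, dotProduct_smul, dotProduct_transpose_mulVec, smul_eq_mul] at h2
  rw [inner_sub_left]
  have e : 2 * (1 / (2 * (n : ℝ))) = 1 / (n : ℝ) := by
    rw [one_div, one_div, mul_inv, mul_inv_cancel_left₀ two_ne_zero]
  rw [e]
  linarith

theorem continuousOn_uUpdate (hC : ∀ j, (C j).PosDef) (hlam : 0 < lam) :
    ContinuousOn (uUpdate A y g C lam) {θ | ∀ j, 0 < θ j} := by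
  obtain ⟨W, hW⟩ := exists_isWhitening hC
  rw [continuousOn_iff_continuous_domRestrict]
  have hinv : Continuous fun θ : {θ : Fin k → ℝ | ∀ j, 0 < θ j} => (blockCov g C θ.1)⁻¹ := by
    have e : (fun θ : {θ : Fin k → ℝ | ∀ j, 0 < θ j} => (blockCov g C θ.1)⁻¹) = fun θ => _ :=
      funext fun θ => blockCov_inv hC θ.2
    rw [e]
    refine (Continuous.matrix_blockDiagonal' (continuous_pi fun j => ?_)).matrix_reindex _ _
    exact (((continuous_apply j).comp continuous_subtype_val).inv₀
      fun θ => (θ.2 j).ne').smul continuous_const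
  have hM : Continuous fun θ : {θ : Fin k → ℝ | ∀ j, 0 < θ j} => normalMatrix A g C lam θ.1 := by
    unfold normalMatrix
    fun_prop
  have hMinv : Continuous fun θ : {θ : Fin k → ℝ | ∀ j, 0 < θ j} =>
      (normalMatrix A g C lam θ.1)⁻¹ := by
    rw [continuous_iff_continuousAt]
    intro θ
    have hdet := (Matrix.isUnit_iff_isUnit_det _).1
      (hW.isUnit_normalMatrix (A := A) hC hlam θ.2)
    have h := continuousAt_matrix_inv (normalMatrix A g C lam θ.1) (by
      rw [Ring.inverse_eq_inv']
      exact continuousAt_inv₀ hdet.ne_zero)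
    exact ContinuousAt.comp (f := fun θ : {θ : Fin k → ℝ | ∀ j, 0 < θ j} =>
      normalMatrix A g C lam θ.1) h hM.continuousAt
  exact hMinv.matrix_mulVec continuous_const

/-- The iteration map is started from `u 1`, because `u 0` is arbitrary. -/
theorem IsRun.eq_iterate {u : ℕ → Fin d → ℝ} {θ : ℕ → Fin k → ℝ}
    (h : IsRun A y g C lam η u θ) (hW : IsWhitening g C W) (l : ℕ) :
    u (l + 1) = (fun v => uUpdate A y g C lam (scales W η v))^[l] (u 1) := by
  induction l with
  | zero => rfl
  | succ l ih => rw [Function.iterate_succ_apply', ← ih, h.u_step, h.θ_step, hW.thetaOf_eq]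

end Blocks

end GSIAS

theorem theorem2p2 {n d k : ℕ} (hn : 0 < n)
    (A : Matrix (Fin n) (Fin d) ℝ) (y : Fin n → ℝ) (g : Fin d → Fin k)
    (C : (j : Fin k) → Matrix (GSIAS.Group g j) (GSIAS.Group g j) ℝ) (hC : ∀ j, (C j).PosDef)
    (lam η : ℝ) (hlam : 0 < lam) (hη : 0 < η) :
    StrictConvexOn ℝ (GSIAS.domain d k) (GSIAS.objJ A y g C lam η) ∧
    (∃! p : (Fin d → ℝ) × (Fin k → ℝ), GSIAS.IsMAP A y g C lam η p) ∧
    ∀ (uhat : Fin d → ℝ) (θhat : Fin k → ℝ), GSIAS.IsMAP A y g C lam η (uhat, θhat) →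
      (∃ μ : ℝ, 0 ≤ μ ∧ μ < 1 ∧
        ∀ (u : ℕ → Fin d → ℝ) (θ : ℕ → Fin k → ℝ), GSIAS.IsRun A y g C lam η u θ →
          Filter.Tendsto
            (fun l => GSIAS.mahalanobisNorm (GSIAS.blockCov g C θhat) (u l - uhat))
            Filter.atTop (nhds 0) ∧
          ∃ L : ℕ, ∀ l, L ≤ l →
            GSIAS.mahalanobisNorm (GSIAS.blockCov g C θhat) (u (l + 1) - uhat)
              ≤ μ * GSIAS.mahalanobisNorm (GSIAS.blockCov g C θhat) (u l - uhat)) ∧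
      IsMinOn (GSIAS.objF A y g C lam η) Set.univ uhat ∧
      ∀ v : Fin d → ℝ, IsMinOn (GSIAS.objF A y g C lam η) Set.univ v → v = uhat := by
  open GSIAS Filter in
  obtain ⟨W, hW⟩ := exists_isWhitening hC
  have hW0 := hW.eq_zero hC
  have ha : 0 ≤ 1 / (2 * (n : ℝ)) := by positivity
  have hc : 0 < lam / Real.sqrt 2 := by positivity
  have hconv : StrictConvexOn ℝ (domain d k) (energy (forwardMap A) (WithLp.toLp 2 y) W
      (1 / (2 * (n : ℝ))) (lam / Real.sqrt 2) η) := strictConvexOn_energy hW0 ha hc hη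
  have hF : objF A y g C lam η = fun u => energy (forwardMap A) (WithLp.toLp 2 y) W
      (1 / (2 * (n : ℝ))) (lam / Real.sqrt 2) η (u, scales W η u) := funext hW.objF_eq
  refine ⟨hconv.congr fun p hp => (hW.objJ_eq hC hp).symm, ?_, fun uhat θhat hmap => ?_⟩
  · obtain ⟨u, hu⟩ := exists_isMinOn_energy_scales (G := forwardMap A) (y := WithLp.toLp 2 y)
      hW0 ha hc hη
    have hmin := isMinOn_energy_of_reduced hc.le hη hu
    refine ⟨(u, scales W η u), (hW.isMAP_iff hC).2 ⟨scales_pos hη u, hmin⟩, fun p hp => ?_⟩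
    obtain ⟨hpd, hpm⟩ := (hW.isMAP_iff hC).1 hp
    exact hconv.eq_of_isMinOn hpm hmin hpd (scales_pos hη u)
  · obtain ⟨hθ, hmin⟩ := (hW.isMAP_iff hC).1 hmap
    obtain rfl : θhat = scales W η uhat := eq_scales_of_isMinOn hW0 ha hc hη hθ hmin
    have hU : ∀ θ : Fin k → ℝ, (∀ j, 0 < θ j) → IsStationary (forwardMap A) (WithLp.toLp 2 y) W
        (1 / (2 * (n : ℝ))) (lam / Real.sqrt 2) θ (uUpdate A y g C lam θ) :=
      fun θ hθ => hW.isStationary_uUpdate hC hlam hθ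
    simp only [hW.blockNorm_eq hC hθ, hF]
    refine ⟨?_, fun v _ => hmin (scales_pos hη v), fun v hv => ?_⟩
    · obtain ⟨μ, hμ0, hμ1, hμ⟩ := exists_eventually_contraction ha hc hη hU
        (isStationary_of_isMinOn hW0 ha hc hU hθ hmin)
      refine ⟨μ, hμ0, hμ1, fun u θ hrun => ?_⟩
      have hlim : Tendsto u atTop (nhds uhat) := by
        rw [← tendsto_add_atTop_iff_nat 1]
        exact (tendsto_of_iteration hW0 ha hc hη hU (continuousOn_uUpdate hC hlam) hmin _).congr
          fun l => (hrun.eq_iterate hW l).symm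
      constructor
      · have hcont : Continuous fun v =>
            Real.sqrt (∑ j, ‖W j (v - uhat)‖ ^ 2 / scales W η uhat j) := by
          have := fun j => (W j).continuous_of_finiteDimensional
          fun_prop
        simpa [Function.comp_def] using (hcont.tendsto uhat).comp hlim
      · obtain ⟨L, hL⟩ := eventually_atTop.1 (hlim.eventually hμ)
        -- The shift ensures `l ≥ 1`: only then is `θ l` the optimal scale vector of `u l`.
        refine ⟨L + 1, fun l hl => ?_⟩
        obtain ⟨m, rfl⟩ : ∃ m, l = m + 1 := ⟨l - 1, by omega⟩
        have h := hL (m + 1) (by omega)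
        rwa [← hW.thetaOf_eq, ← hrun.θ_step, ← hrun.u_step] at h
    -- A minimizer of `F`, paired with its optimal scales, minimizes the joint energy, where
    -- uniqueness holds.
    · exact congrArg Prod.fst (hconv.eq_of_isMinOn (isMinOn_energy_of_reduced hc.le hη hv) hmin
        (scales_pos hη v) hθ)
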